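/- For $n\ge 1$, let $\mathsf{GOE}(n)$ be the law of the random symmetric $n\times n$ matrix $W$ whose entries $W_{ij}=W_{ji}$, $i\le j$, are independent centred Gaussians with variance $2/n$ if $i=j$ and $1/n$ if $i<j$. For $\rho\in(0,1]$, let $\mathcal X_n^\rho$ (the sparse Rademacher prior) be the law of the random vector $x\in\mathbb R^n$ with i.i.d. entries equal to $1/\sqrt{\rho n}$ and $-1/\sqrt{\rho n}$ with probability $\rho/2$ each, and to $0$ with probability $1-\rho$. For $\lambda\ge 0$, let $\mathbb Q_n=\mathsf{GOE}(n)$ and let $\mathbb P_n=\mathbb P_{n,\lambda,\rho}$ be the law of $Y=W+\lambda xx^\top$, where $W\sim\mathsf{GOE}(n)$ and $x\sim\mathcal X_n^\rho$ are independent (the spiked Wigner model). Let $L_n=\frac{d\mathbb P_n}{d\mathbb Q_n}$ be the likelihood ratio and, for $D\in\mathbb N$, let $L_n^{\le D}$ be the orthogonal projection of $L_n$ in $L^2(\mathbb Q_n)$ onto the polynomials of degree at most $D$ in the entries of $Y$. Theorem. Let $D_n\in\mathbb N$, $\lambda_n\ge 0$ and $\rho_n\in(0,1]$ be sequences with $D_n=o(n)$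 as $n\to\infty$, and take $\lambda=\lambda_n$, $\rho=\rho_n$ in the model above. Suppose that one of the following holds: (a) $\limsup_{n\to\infty}\lambda_n<1$ and, for all sufficiently large $n$, $$\rho_n\ \ge\ \max\left(1,\sqrt{\frac{1}{6\log(1/\lambda_n)}}\right)\sqrt{\frac{D_n}{n}},$$ where the inner square root is read as $0$ if $\lambda_n=0$; or (b) $\limsup_{n\to\infty}\lambda_n<1/\sqrt3$ and, for all sufficiently large $n$, $$\rho_n\ \ge\ \lambda_n\sqrt{\frac{D_n}{n}}.$$ Then $\mathbb P_n$ is absolutely continuous with respect to $\mathbb Q_n$ and $L_n\in L^2(\mathbb Q_n)$ for every $n$, and $\|L_n^{\le D_n}\|_{L^2(\mathbb Q_n)}=O(1)$ as $n\to\infty$. -/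

import Mathlib

open MeasureTheory ProbabilityTheory Filter Asymptotics
open scoped ENNReal

noncomputable section

/-- The space `ℝ[Y]_{≤ D}` inside `L²(Q)`, for a measure `Q` on `ℝ^ι`: the classes of functions
that agree `Q`-almost everywhere with a polynomial of total degree at most `D` in the coordinates.
(When `Q` has finite moments, as for Gaussian measures, every polynomial gives such a class.) -/
def polyLE {ι : Type} [Fintype ι] (Q : Measure (ι → ℝ)) (D : ℕ) :
    Submodule ℝ (Lp ℝ 2 Q) where
  carrier := {g | ∃ p : MvPolynomial ι ℝ, p.totalDegree ≤ D ∧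
    (g : (ι → ℝ) → ℝ) =ᵐ[Q] fun Y => MvPolynomial.eval Y p}
  add_mem' := by
    rintro f g ⟨p, hp, hfp⟩ ⟨q, hq, hgq⟩
    refine ⟨p + q, (MvPolynomial.totalDegree_add p q).trans (max_le hp hq), ?_⟩
    filter_upwards [Lp.coeFn_add f g, hfp, hgq] with Y h1 h2 h3
    rw [h1, Pi.add_apply, h2, h3, map_add]
  zero_mem' := by
    refine ⟨0, by simp, ?_⟩
    filter_upwards [Lp.coeFn_zero ℝ 2 Q] with Y h
    rw [h, Pi.zero_apply, map_zero]
  smul_mem' := by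
    rintro c f ⟨p, hp, hfp⟩
    refine ⟨c • p, (MvPolynomial.totalDegree_smul_le c p).trans hp, ?_⟩
    filter_upwards [Lp.coeFn_smul c f, hfp] with Y h1 h2
    rw [h1, Pi.smul_apply, h2, MvPolynomial.smul_eval, smul_eq_mul]

/-- `ℝ[Y]_{≤ D}` is finite-dimensional, so the orthogonal projection onto it exists. -/
instance polyLE_finiteDimensional {ι : Type} [Fintype ι] (Q : Measure (ι → ℝ)) (D : ℕ) :
    FiniteDimensional ℝ (polyLE Q D) := by
  let germ : MvPolynomial.restrictTotalDegree ι ℝ D →ₗ[ℝ] ((ι → ℝ) →ₘ[Q] ℝ) :=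
    { toFun := fun p => AEEqFun.mk (fun Y => MvPolynomial.eval Y p.1)
        (MvPolynomial.continuous_eval p.1).aestronglyMeasurable
      map_add' := fun p q => by
        rw [AEEqFun.mk_add_mk]
        congr 1
        ext Y
        simp
      map_smul' := fun c p => by
        apply AEEqFun.ext
        filter_upwards [AEEqFun.coeFn_mk (fun Y => MvPolynomial.eval Y (c • p).1)
            (MvPolynomial.continuous_eval (c • p).1).aestronglyMeasurable,
          AEEqFun.coeFn_mk (fun Y => MvPolynomial.eval Y p.1)
            (MvPolynomial.continuous_eval p.1).aestronglyMeasurable (μ := Q),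
          AEEqFun.coeFn_smul c (AEEqFun.mk (μ := Q) (fun Y => MvPolynomial.eval Y p.1)
            (MvPolynomial.continuous_eval p.1).aestronglyMeasurable)] with Y h1 h2 h3
        rw [h1, RingHom.id_apply, h3, Pi.smul_apply, h2]
        simp [MvPolynomial.smul_eval] }
  have hmem : ∀ g : polyLE Q D, ((g : Lp ℝ 2 Q) : (ι → ℝ) →ₘ[Q] ℝ) ∈ LinearMap.range germ := by
    rintro ⟨g, p, hp, hg⟩
    refine ⟨⟨p, (MvPolynomial.mem_restrictTotalDegree _ _ _).2 hp⟩, ?_⟩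
    apply AEEqFun.ext
    exact (AEEqFun.coeFn_mk _ _).trans hg.symm
  let emb : polyLE Q D →ₗ[ℝ] LinearMap.range germ :=
    { toFun := fun g => ⟨_, hmem g⟩
      map_add' := fun _ _ => rfl
      map_smul' := fun _ _ => rfl }
  refine Module.Finite.of_injective emb fun f g h => ?_
  have h' : ((f : Lp ℝ 2 Q) : (ι → ℝ) →ₘ[Q] ℝ) = ((g : Lp ℝ 2 Q) : (ι → ℝ) →ₘ[Q] ℝ) :=
    congrArg (fun t : LinearMap.range germ => (t : (ι → ℝ) →ₘ[Q] ℝ)) h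
  exact Subtype.ext (Subtype.ext h')

/-- `f ↦ f^{≤ D}`: the orthogonal projection in `L²(Q)` onto `ℝ[Y]_{≤ D}`. -/
def lowDegProj {ι : Type} [Fintype ι] (Q : Measure (ι → ℝ)) (D : ℕ) (f : Lp ℝ 2 Q) : Lp ℝ 2 Q :=
  (polyLE Q D).starProjection f

/-- The likelihood ratio `dP/dQ`, as a real-valued function. -/
def likelihoodRatio {Ω : Type} [MeasurableSpace Ω] (P Q : Measure Ω) (Y : Ω) : ℝ :=
  (P.rnDeriv Q Y).toReal

/-- `GOE(n)`: the law of the symmetric `n × n` matrix `W` whose entries, one for each unordered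
pair of indices, are independent centred Gaussians with `Var W i i = 2 / n` and
`Var W i j = 1 / n` for `i ≠ j`. -/
def goe (n : ℕ) : Measure (Fin n × Fin n → ℝ) :=
  (Measure.pi fun z : Sym2 (Fin n) =>
    gaussianReal 0 (if z.IsDiag then 2 / (n : NNReal) else 1 / (n : NNReal))).map
    fun g p => g s(p.1, p.2)

/-- The law of one entry of the sparse Rademacher vector: `± 1 / √(ρ n)` with probability `ρ / 2`
each, and `0` with probability `1 - ρ`. -/
def sparseRademacherEntry (n : ℕ) (ρ : ℝ) : Measure ℝ :=
  ENNReal.ofReal (ρ / 2) • Measure.dirac (1 / Real.sqrt (ρ * n)) +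
  ENNReal.ofReal (ρ / 2) • Measure.dirac (-(1 / Real.sqrt (ρ * n))) +
  ENNReal.ofReal (1 - ρ) • Measure.dirac 0

/-- The sparse Rademacher prior on `ℝⁿ`: i.i.d. entries. -/
def sparseRademacher (n : ℕ) (ρ : ℝ) : Measure (Fin n → ℝ) :=
  Measure.pi fun _ => sparseRademacherEntry n ρ

/-- The planted law of the spiked Wigner model with spike prior `X`: the law of `W + lam * x xᵀ`
with `W ∼ GOE(n)` and `x ∼ X` independent. The null law is `goe n`. -/
def spikedWigner (n : ℕ) (lam : ℝ) (X : Measure (Fin n → ℝ)) : Measure (Fin n × Fin n → ℝ) :=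
  ((goe n).prod X).map fun w p => w.1 p + lam * (w.2 p.1 * w.2 p.2)

end

/-! ### Gaussian integration by parts, directional Hermite polynomials and Taylor's formula. -/

section GaussianPolynomials

open MvPolynomial

/-! The projection G of the likelihood ratio L satisfies ‖G‖² = ⟨L, G⟩, which is the planted
expectation of G. So it suffices to compare planted expectations of polynomials of degree at most D
with their null L² norms. The planted law is a finite mixture of Gaussian shifts, one for each of
the 3^n sign patterns of the spike. For a shift by m, Taylor's formula and integration by parts give
E q(y + m) = ∑_{k ≤ D} E[H_k q] / k!, with H_k the Hermite polynomial in direction m. Hermite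
orthogonality and Cauchy–Schwarz (`sq_sum_integral_shift_le`) then give ‖G‖² ≤ ∑_{k ≤ D} (1 / k!) E
(n λ² ⟨x, x'⟩² / 2)^k, where x, x' are independent copies of the spike.

The overlap moments are controlled through y^{2k} ≤ (2k)! cosh y and the explicit moment generating
function of ⟨x, x'⟩. With r = k / (n ρ²) and any t > 0, `degreeTerm_le` bounds the k-th term by e k
B^k, where B = 2 λ² r / (e t²) · exp((cosh t - 1) / r). It remains to choose t so that B stays below
a constant less than 1, since ∑ k q^k converges for 0 ≤ q < 1.

Taking t² = 2r gives B ≤ λ² exp((r/6) / (1 - r/15)) for r < 15. In case (a), r ≤ 1 and, for λ > 0,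
r/6 ≤ log(1/λ), whence B ≤ √λ. In case (b), λ² r ≤ 1 and λ² ≤ 1/3: the same t gives B ≤ 2/3 when r ≤
3, and t = 2 gives B ≤ 1/2 when r > 3. -/

theorem integrable_pow_gaussianReal (μ : ℝ) (v : NNReal) (k : ℕ) :
    Integrable (fun x : ℝ => x ^ k) (gaussianReal μ v) := by
  have h := memLp_id_gaussianReal (μ := μ) (v := v) (k : NNReal)
  simpa using h.integrable_norm_pow' |>.mono (by fun_prop)
    (Eventually.of_forall fun x => by simp)

/-- The recurrence between the moments of a centred Gaussian. -/
theorem integral_pow_succ_gaussianReal (v : NNReal) (k : ℕ) :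
    ∫ x, x ^ (k + 1) ∂(gaussianReal 0 v) =
      v * (k * ∫ x, x ^ (k - 1) ∂(gaussianReal 0 v)) := by
  rcases eq_or_ne v 0 with rfl | hv
  · simp
  have hint : ∀ j : ℕ, Integrable fun x : ℝ => gaussianPDFReal 0 v x * x ^ j := fun j => by
    have h := integrable_pow_gaussianReal 0 v j
    rw [gaussianReal_of_var_ne_zero 0 hv, integrable_withDensity_iff (by fun_prop)
      (by simp [gaussianPDF])] at h
    simpa [toReal_gaussianPDF, mul_comm] using h
  have hd : ∀ x : ℝ, HasDerivAt (gaussianPDFReal 0 v) (-(x / v) * gaussianPDFReal 0 v x) x := by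
    intro x
    have h1 : HasDerivAt (fun x : ℝ => -(x - 0) ^ 2 / (2 * v)) (-(x / v)) x := by
      have := (((hasDerivAt_id x).sub_const 0).pow 2).neg.div_const (2 * (v : ℝ))
      have hv' : (v : ℝ) ≠ 0 := by exact_mod_cast hv
      refine HasDerivAt.congr_deriv this ?_
      simp
      field_simp
    have h2 := h1.exp.const_mul ((Real.sqrt (2 * Real.pi * v))⁻¹)
    rw [gaussianPDFReal_def]
    exact h2.congr_deriv (by ring)
  have hv' : (v : ℝ) ≠ 0 := by exact_mod_cast hv
  -- Integration by parts of x^k against the density, whose derivative is -(x / v) times itself. The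
  -- truncated `k - 1` at k = 0 is harmless because of the factor k.
  have key := integral_mul_deriv_eq_deriv_mul_of_integrable
    (u := fun x : ℝ => x ^ k) (u' := fun x => k * x ^ (k - 1)) (v := gaussianPDFReal 0 v)
    (v' := fun x => -(x / v) * gaussianPDFReal 0 v x)
    (fun x _ => hasDerivAt_pow k x) (fun x _ => hd x)
    (by
      refine ((hint (k + 1)).const_mul (-(1 / (v : ℝ)))).congr (Eventually.of_forall fun x => ?_)
      simp only [Pi.mul_apply]
      ring)
    (by
      refine ((hint (k - 1)).const_mul (k : ℝ)).congr (Eventually.of_forall fun x => ?_)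
      simp only [Pi.mul_apply]
      ring)
    (by
      refine (hint k).congr (Eventually.of_forall fun x => ?_)
      simp only [Pi.mul_apply]
      ring)
  simp only [integral_gaussianReal_eq_integral_smul hv, smul_eq_mul]
  have e1 : ∫ x : ℝ, x ^ k * (-(x / v) * gaussianPDFReal 0 v x) =
      -(1 / (v : ℝ)) * ∫ x : ℝ, gaussianPDFReal 0 v x * x ^ (k + 1) := by
    rw [← integral_const_mul]
    congr 1 with x
    ring
  have e2 : ∫ x : ℝ, (k * x ^ (k - 1)) * gaussianPDFReal 0 v x =
      k * ∫ x : ℝ, gaussianPDFReal 0 v x * x ^ (k - 1) := by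
    rw [← integral_const_mul]
    congr 1 with x
    ring
  rw [e1, e2] at key
  field_simp at key
  linarith

variable {ι : Type} [Fintype ι]

theorem integrable_eval_gaussian (v : ι → NNReal) (q : MvPolynomial ι ℝ) :
    Integrable (fun y => eval y q) (Measure.pi fun z => gaussianReal 0 (v z)) := by
  simp only [eval_eq']
  refine integrable_finsetSum _ fun d _ => Integrable.const_mul ?_ _
  exact Integrable.fintype_prod (f := fun i (x : ℝ) => x ^ d i)
    fun i => integrable_pow_gaussianReal 0 (v i) (d i)

/-- Stein's identity for polynomials. -/
theorem integral_X_mul_gaussian (v : ι → NNReal) (z : ι) (q : MvPolynomial ι ℝ) :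
    ∫ y, eval y (X z * q) ∂(Measure.pi fun z => gaussianReal 0 (v z)) =
      v z * ∫ y, eval y (pderiv z q) ∂(Measure.pi fun z => gaussianReal 0 (v z)) := by
  classical
  induction q using MvPolynomial.induction_on' with
  | monomial d a =>
    have hX : X z * monomial d a = monomial (d + Finsupp.single z 1) a := by
      rw [X, monomial_mul, one_mul, add_comm]
    have hmon : ∀ (e : ι →₀ ℕ) (b : ℝ),
        ∫ y, eval y (monomial e b) ∂(Measure.pi fun z => gaussianReal 0 (v z)) =
          b * ∏ i, ∫ x, x ^ e i ∂(gaussianReal 0 (v i)) := by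
      intro e b
      rw [← integral_fintype_prod_eq_prod (f := fun i (x : ℝ) => x ^ e i), ← integral_const_mul]
      congr 1 with y
      rw [eval_monomial, Finsupp.prod_fintype _ _ (by simp)]
    rw [hX, pderiv_monomial, hmon, hmon, ← Finset.mul_prod_erase _ _ (Finset.mem_univ z),
      ← Finset.mul_prod_erase _ (fun i => ∫ x, x ^ ((d - Finsupp.single z 1 : ι →₀ ℕ) i)
        ∂(gaussianReal 0 (v i))) (Finset.mem_univ z)]
    have h1 : ∀ i ∈ Finset.univ.erase z, (d + Finsupp.single z 1 : ι →₀ ℕ) i = d i ∧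
        (d - Finsupp.single z 1 : ι →₀ ℕ) i = d i := by
      intro i hi
      simp [(Finset.ne_of_mem_erase hi).symm]
    rw [Finset.prod_congr rfl fun i hi => by rw [(h1 i hi).1],
      Finset.prod_congr (f := fun i => ∫ x, x ^ ((d - Finsupp.single z 1 : ι →₀ ℕ) i)
          ∂(gaussianReal 0 (v i))) (g := fun i => ∫ x, x ^ d i ∂(gaussianReal 0 (v i))) rfl
        fun i hi => by rw [(h1 i hi).2]]
    simp only [Finsupp.add_apply, Finsupp.tsub_apply, Finsupp.single_eq_same]
    rw [integral_pow_succ_gaussianReal]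
    ring
  | add p q hp hq =>
    simp only [mul_add, map_add]
    rw [integral_add (integrable_eval_gaussian v _) (integrable_eval_gaussian v _), hp, hq,
      integral_add (integrable_eval_gaussian v _) (integrable_eval_gaussian v _)]
    ring

/-- The derivation `∑ z, m z • ∂ / ∂ z`. -/
noncomputable def dirDeriv (m : ι → ℝ) : Derivation ℝ (MvPolynomial ι ℝ) (MvPolynomial ι ℝ) :=
  ∑ z, m z • pderiv z

theorem dirDeriv_apply (m : ι → ℝ) (q : MvPolynomial ι ℝ) :
    dirDeriv m q = ∑ z, m z • pderiv z q := by
  have h := congrFun (map_sum (Derivation.coeFnAddMonoidHom (R := ℝ) (A := MvPolynomial ι ℝ)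
    (M := MvPolynomial ι ℝ)) (fun z => m z • pderiv z) Finset.univ) q
  rw [Finset.sum_apply] at h
  exact h

theorem dirDeriv_X (m : ι → ℝ) (z : ι) : dirDeriv m (X z) = C (m z) := by
  classical
  rw [dirDeriv_apply]
  simp [pderiv_X, Pi.single_apply, smul_eq_C_mul]

/-- The commutator is again a derivation, and it kills every variable because the directions have
constant coefficients. -/
theorem dirDeriv_comm (m m' : ι → ℝ) (q : MvPolynomial ι ℝ) :
    dirDeriv m (dirDeriv m' q) = dirDeriv m' (dirDeriv m q) := by
  have h : ⁅dirDeriv m, dirDeriv m'⁆ = 0 := by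
    refine MvPolynomial.derivation_ext fun z => ?_
    rw [Derivation.commutator_apply, dirDeriv_X, dirDeriv_X]
    simp [← algebraMap_eq]
  have h' := congrArg (fun d : Derivation ℝ (MvPolynomial ι ℝ) (MvPolynomial ι ℝ) => d q) h
  simpa [Derivation.commutator_apply, sub_eq_zero] using h'

/-- The inner product on `ℝ^ι` with weights `1 / v`. -/
noncomputable def wInner (v : ι → NNReal) (m m' : ι → ℝ) : ℝ := ∑ z, m z * m' z / v z

/-- The linear form `y ↦ ∑ z, m z * y z / v z`. -/
noncomputable def linForm (v : ι → NNReal) (m : ι → ℝ) : MvPolynomial ι ℝ :=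
  ∑ z, (m z / v z) • X z

theorem dirDeriv_linForm (v : ι → NNReal) (m m' : ι → ℝ) :
    dirDeriv m (linForm v m') = C (wInner v m m') := by
  simp only [linForm, wInner, map_sum, Derivation.map_smul, dirDeriv_X]
  simp only [smul_eq_C_mul, ← C_mul]
  refine Finset.sum_congr rfl fun z _ => ?_
  congr 1
  ring

theorem integral_linForm_mul (v : ι → NNReal) (hv : ∀ z, v z ≠ 0) (m : ι → ℝ)
    (q : MvPolynomial ι ℝ) :
    ∫ y, eval y (linForm v m * q) ∂(Measure.pi fun z => gaussianReal 0 (v z)) =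
      ∫ y, eval y (dirDeriv m q) ∂(Measure.pi fun z => gaussianReal 0 (v z)) := by
  rw [dirDeriv_apply]
  simp only [linForm, Finset.sum_mul, map_sum, smul_mul_assoc, smul_eval]
  rw [integral_finsetSum _ fun z _ => (integrable_eval_gaussian v _).const_mul _,
    integral_finsetSum _ fun z _ => (integrable_eval_gaussian v _).const_mul _]
  refine Finset.sum_congr rfl fun z _ => ?_
  have : (v z : ℝ) ≠ 0 := by exact_mod_cast hv z
  rw [integral_const_mul, integral_const_mul, integral_X_mul_gaussian]
  field_simp

/-- The Hermite polynomial of degree `k` in the direction `m`, for independent centred Gaussians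
of variances `v`. -/
noncomputable def dirHermite (v : ι → NNReal) (m : ι → ℝ) : ℕ → MvPolynomial ι ℝ
  | 0 => 1
  | k + 1 => linForm v m * dirHermite v m k - dirDeriv m (dirHermite v m k)

/-- Multiplication by a Hermite polynomial is adjoint to iterated differentiation: the term
subtracted in the Hermite recursion is exactly the Leibniz term left by Stein's identity. -/
theorem integral_dirHermite_mul (v : ι → NNReal) (hv : ∀ z, v z ≠ 0) (m : ι → ℝ) (k : ℕ)
    (q : MvPolynomial ι ℝ) :
    ∫ y, eval y (dirHermite v m k * q) ∂(Measure.pi fun z => gaussianReal 0 (v z)) =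
      ∫ y, eval y ((dirDeriv m)^[k] q) ∂(Measure.pi fun z => gaussianReal 0 (v z)) := by
  induction k generalizing q with
  | zero => simp [dirHermite]
  | succ k ih =>
    rw [Function.iterate_succ_apply, ← ih, dirHermite]
    have h : (linForm v m * dirHermite v m k - dirDeriv m (dirHermite v m k)) * q =
        linForm v m * (dirHermite v m k * q) - dirDeriv m (dirHermite v m k) * q := by ring
    have h2 : dirDeriv m (dirHermite v m k * q) =
        dirHermite v m k * dirDeriv m q + dirDeriv m (dirHermite v m k) * q := by
      rw [Derivation.leibniz, smul_eq_mul, smul_eq_mul]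
      ring
    rw [h]
    simp only [map_sub]
    rw [integral_sub (integrable_eval_gaussian v _) (integrable_eval_gaussian v _),
      integral_linForm_mul v hv, h2]
    simp only [map_add]
    rw [integral_add (integrable_eval_gaussian v _) (integrable_eval_gaussian v _)]
    ring

theorem dirDeriv_dirHermite_succ (v : ι → NNReal) (m m' : ι → ℝ) (l : ℕ) :
    dirDeriv m (dirHermite v m' (l + 1)) =
      C ((l + 1 : ℝ) * wInner v m m') * dirHermite v m' l := by
  induction l with
  | zero => simp [dirHermite, dirDeriv_linForm]
  | succ l ih =>
    rw [dirHermite, map_sub, Derivation.leibniz, dirDeriv_comm, ih, dirDeriv_linForm,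
      Derivation.leibniz, dirHermite]
    have : dirDeriv m' (C ((l + 1 : ℝ) * wInner v m m')) = 0 := by
      rw [← algebraMap_eq, Derivation.map_algebraMap]
    rw [this]
    simp only [smul_eq_mul, C_mul, C_add, map_one, Nat.cast_add, Nat.cast_one]
    ring

/-- Moving the first factor over as k derivatives lowers the second degree step by step. Unless k =
l, this ends with a derivative of a constant or a Hermite polynomial of positive degree, which has
mean zero. -/
theorem integral_dirHermite_mul_dirHermite (v : ι → NNReal) (hv : ∀ z, v z ≠ 0) (m m' : ι → ℝ)
    (k l : ℕ) :
    ∫ y, eval y (dirHermite v m k * dirHermite v m' l)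
        ∂(Measure.pi fun z => gaussianReal 0 (v z)) =
      if k = l then k.factorial * wInner v m m' ^ k else 0 := by
  rw [integral_dirHermite_mul v hv]
  induction k generalizing l with
  | zero =>
    cases l with
    | zero => simp [dirHermite]
    | succ l =>
      have h := integral_dirHermite_mul v hv m' (l + 1) 1
      rw [mul_one, Function.iterate_succ_apply, Derivation.map_one_eq_zero,
        Function.iterate_fixed (map_zero _)] at h
      simpa using h
  | succ k ih =>
    rw [Function.iterate_succ_apply]
    cases l with
    | zero =>
      rw [dirHermite, Derivation.map_one_eq_zero, Function.iterate_fixed (map_zero _)]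
      simp
    | succ l =>
      have h : (dirDeriv m)^[k] (C ((l + 1 : ℝ) * wInner v m m') * dirHermite v m' l) =
          ((l + 1 : ℝ) * wInner v m m') • (dirDeriv m)^[k] (dirHermite v m' l) := by
        rw [← smul_eq_C_mul]
        exact (Function.Commute.iterate_left (f := dirDeriv m) (g := fun q : MvPolynomial ι ℝ =>
          ((l + 1 : ℝ) * wInner v m m') • q) (fun q => Derivation.map_smul _ _ _) k).eq _
      rw [dirDeriv_dirHermite_succ, h]
      simp only [smul_eval]
      rw [integral_const_mul, ih]
      rcases eq_or_ne k l with rfl | hkl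
      · simp [Nat.factorial_succ, pow_succ]
        ring
      · simp [hkl]

/-- Taylor's formula for polynomials in several variables. -/
theorem eval_add_eq_sum_dirDeriv (m y : ι → ℝ) (q : MvPolynomial ι ℝ) {D : ℕ}
    (hq : q.totalDegree ≤ D) :
    eval (fun z => y z + m z) q =
      ∑ k ∈ Finset.range (D + 1), (k.factorial : ℝ)⁻¹ * eval y ((dirDeriv m)^[k] q) := by
  -- Restriction to the line t ↦ y + t m, which turns `dirDeriv m` into d/dt and reduces the claim
  -- to one variable, read at t = 1.
  let Φ : MvPolynomial ι ℝ →ₐ[ℝ] Polynomial ℝ :=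
    aeval fun z => Polynomial.C (y z) + Polynomial.C (m z) * Polynomial.X
  have hder : ∀ p, Polynomial.derivative (Φ p) = Φ (dirDeriv m p) := by
    intro p
    induction p using MvPolynomial.induction_on with
    | C a => simp [Φ, ← algebraMap_eq]
    | add p q hp hq => simp only [map_add, hp, hq]
    | mul_X p z hp =>
      rw [map_mul, Polynomial.derivative_mul, hp, Derivation.leibniz, dirDeriv_X]
      simp [Φ]
      ring
  have hiter : ∀ k p, Polynomial.derivative^[k] (Φ p) = Φ ((dirDeriv m)^[k] p) := by
    intro k
    induction k with
    | zero => simp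
    | succ k ih => intro p; rw [Function.iterate_succ_apply, hder, ih, Function.iterate_succ_apply]
  have hev : ∀ (t : ℝ) p, (Φ p).eval t = eval (fun z => y z + m z * t) p := by
    intro t p
    induction p using MvPolynomial.induction_on with
    | C a => simp [Φ]
    | add p q hp hq => simp only [map_add, Polynomial.eval_add, hp, hq]
    | mul_X p z hp =>
      rw [map_mul, Polynomial.eval_mul, hp, map_mul]
      simp [Φ]
  have hdeg : (Φ q).natDegree < D + 1 := by
    refine Nat.lt_succ_of_le ?_
    have := MvPolynomial.aeval_natDegree_le (m := D) (n := 1) q hq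
      (fun z => Polynomial.C (y z) + Polynomial.C (m z) * Polynomial.X)
      (fun z => by compute_degree)
    simpa using this
  have h1 := hev 1 q
  simp only [mul_one] at h1
  rw [← h1, Polynomial.eval_eq_sum_range' hdeg]
  refine Finset.sum_congr rfl fun k _ => ?_
  have h2 : eval y ((dirDeriv m)^[k] q) = k.factorial * (Φ q).coeff k := by
    have := hev 0 ((dirDeriv m)^[k] q)
    simp only [mul_zero, add_zero] at this
    rw [← this, ← hiter, ← Polynomial.coeff_zero_eq_eval_zero, Polynomial.coeff_iterate_derivative]
    simp [Nat.descFactorial_self]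
  have hk : (k.factorial : ℝ) ≠ 0 := by positivity
  rw [h2]
  field_simp
  simp

end GaussianPolynomials

/-! ### Averages of Gaussian shifts: the low-degree bound, densities and square integrability. -/

section GaussianShift

open MvPolynomial

variable {ι : Type} [Fintype ι]

/-- Cauchy–Schwarz, from the discriminant of the nonnegative quadratic t ↦ ∫ (t q + p)². -/
theorem sq_integral_mul_le_gaussian (v : ι → NNReal) (p q : MvPolynomial ι ℝ) :
    (∫ y, eval y (p * q) ∂(Measure.pi fun z => gaussianReal 0 (v z))) ^ 2 ≤
      (∫ y, eval y (q * q) ∂(Measure.pi fun z => gaussianReal 0 (v z))) *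
        ∫ y, eval y (p * p) ∂(Measure.pi fun z => gaussianReal 0 (v z)) := by
  set γ := Measure.pi fun z => gaussianReal 0 (v z)
  have h : ∀ t : ℝ, 0 ≤ (∫ y, eval y (q * q) ∂γ) * (t * t) +
      (2 * ∫ y, eval y (p * q) ∂γ) * t + ∫ y, eval y (p * p) ∂γ := by
    intro t
    have h0 : 0 ≤ ∫ y, eval y ((C t * q + p) * (C t * q + p)) ∂γ :=
      integral_nonneg fun y => by simpa using mul_self_nonneg _
    have h1 : (C t * q + p) * (C t * q + p) =
        C (t * t) * (q * q) + (C (2 * t) * (p * q) + p * p) := by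
      simp only [C_mul, show (C (2 : ℝ) : MvPolynomial ι ℝ) = 2 from map_ofNat C 2]
      ring
    have hadd : ∀ a b : MvPolynomial ι ℝ,
        ∫ y, eval y (a + b) ∂γ = ∫ y, eval y a ∂γ + ∫ y, eval y b ∂γ := fun a b => by
      simp only [map_add]
      exact integral_add (integrable_eval_gaussian v a) (integrable_eval_gaussian v b)
    have hC : ∀ (a : ℝ) (b : MvPolynomial ι ℝ),
        ∫ y, eval y (C a * b) ∂γ = a * ∫ y, eval y b ∂γ := fun a b => by
      simp only [map_mul, eval_C, integral_const_mul]
    rw [h1, hadd, hadd, hC, hC] at h0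
    linarith
  have := discrim_le_zero h
  rw [discrim] at this
  linarith

/-- Gaussian mean shifts, averaged with weights `w`, applied to a polynomial of degree at most `D`:
their norm is controlled by the truncated exponential of the inner products of the shifts. -/
theorem sq_sum_integral_shift_le (v : ι → NNReal) (hv : ∀ z, v z ≠ 0) {Ω : Type} [Fintype Ω]
    (w : Ω → ℝ) (m : Ω → ι → ℝ) (q : MvPolynomial ι ℝ) {D : ℕ} (hq : q.totalDegree ≤ D) :
    (∑ ω, w ω * ∫ y, eval (fun z => y z + m ω z) q
        ∂(Measure.pi fun z => gaussianReal 0 (v z))) ^ 2 ≤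
      (∫ y, eval y (q * q) ∂(Measure.pi fun z => gaussianReal 0 (v z))) *
        ∑ k ∈ Finset.range (D + 1), (k.factorial : ℝ)⁻¹ *
          ∑ ω, ∑ ω', w ω * w ω' * wInner v (m ω) (m ω') ^ k := by
  set γ := Measure.pi fun z => gaussianReal 0 (v z)
  have hi := fun q => integrable_eval_gaussian v q
  -- The Hermite expansion of the mixture density, cut at degree D. It represents the averaged shift
  -- on polynomials of degree at most D, and its squared norm is the right-hand sum.
  let h : MvPolynomial ι ℝ := ∑ ω, ∑ k ∈ Finset.range (D + 1),
    (w ω * (k.factorial : ℝ)⁻¹) • dirHermite v (m ω) k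
  have hmul : ∀ r : MvPolynomial ι ℝ, ∫ y, eval y (h * r) ∂γ =
      ∑ ω, ∑ k ∈ Finset.range (D + 1), w ω * (k.factorial : ℝ)⁻¹ *
        ∫ y, eval y (dirHermite v (m ω) k * r) ∂γ := by
    intro r
    simp only [h, Finset.sum_mul, map_sum, smul_mul_assoc, smul_eval]
    rw [integral_finsetSum _ fun ω _ => integrable_finsetSum _ fun k _ => (hi _).const_mul _]
    refine Finset.sum_congr rfl fun ω _ => ?_
    rw [integral_finsetSum _ fun k _ => (hi _).const_mul _]
    simp only [integral_const_mul]
    rfl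
  have h1 : ∑ ω, w ω * ∫ y, eval (fun z => y z + m ω z) q ∂γ = ∫ y, eval y (h * q) ∂γ := by
    rw [hmul]
    refine Finset.sum_congr rfl fun ω _ => ?_
    simp only [eval_add_eq_sum_dirDeriv (m ω) _ q hq]
    rw [integral_finsetSum _ fun k _ => (hi _).const_mul _, Finset.mul_sum]
    refine Finset.sum_congr rfl fun k _ => ?_
    rw [integral_const_mul, integral_dirHermite_mul v hv, mul_assoc]
  have h2 : ∫ y, eval y (h * h) ∂γ = ∑ k ∈ Finset.range (D + 1), (k.factorial : ℝ)⁻¹ *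
      ∑ ω, ∑ ω', w ω * w ω' * wInner v (m ω) (m ω') ^ k := by
    rw [hmul, Finset.sum_comm]
    refine Finset.sum_congr rfl fun k hk => ?_
    rw [Finset.mul_sum]
    refine Finset.sum_congr rfl fun ω _ => ?_
    rw [mul_comm (dirHermite v (m ω) k) h, hmul, Finset.mul_sum, Finset.mul_sum]
    refine Finset.sum_congr rfl fun ω' _ => ?_
    have hk' : (k.factorial : ℝ) ≠ 0 := by positivity
    rw [Finset.sum_eq_single k]
    · rw [mul_comm (dirHermite v (m ω') k), integral_dirHermite_mul_dirHermite v hv, if_pos rfl]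
      field_simp
    · intro l _ hl
      rw [mul_comm (dirHermite v (m ω') l), integral_dirHermite_mul_dirHermite v hv,
        if_neg hl.symm, mul_zero]
    · exact fun h => absurd hk h
  rw [h1, ← h2]
  exact sq_integral_mul_le_gaussian v h q

/-- The density of the shift by `m` of independent centred Gaussians of variances `v`. -/
noncomputable def expTilt (v : ι → NNReal) (m y : ι → ℝ) : ℝ :=
  ∏ z, Real.exp (m z * y z / v z - m z ^ 2 / (2 * v z))

theorem measurable_expTilt (v : ι → NNReal) (m : ι → ℝ) : Measurable (expTilt v m) := by
  unfold expTilt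
  fun_prop

theorem expTilt_nonneg (v : ι → NNReal) (m y : ι → ℝ) : 0 ≤ expTilt v m y :=
  Finset.prod_nonneg fun _ _ => (Real.exp_pos _).le

theorem gaussianReal_eq_withDensity {v : NNReal} (hv : v ≠ 0) (a : ℝ) :
    gaussianReal a v = (gaussianReal 0 v).withDensity
      fun x => ENNReal.ofReal (Real.exp (a * x / v - a ^ 2 / (2 * v))) := by
  have hv' : (v : ℝ) ≠ 0 := by exact_mod_cast hv
  rw [gaussianReal_of_var_ne_zero a hv, gaussianReal_of_var_ne_zero 0 hv,
    ← withDensity_mul _ (by fun_prop) (by fun_prop)]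
  congr 1 with x
  rw [Pi.mul_apply, gaussianPDF, gaussianPDF, ← ENNReal.ofReal_mul (gaussianPDFReal_nonneg _ _ _),
    gaussianPDFReal_def, gaussianPDFReal_def]
  simp only
  rw [mul_assoc _ (Real.exp _) (Real.exp _), ← Real.exp_add]
  congr 3
  field_simp
  ring

theorem lintegral_pi_prod {μ : ι → Measure ℝ} [∀ i, IsProbabilityMeasure (μ i)]
    {g : ι → ℝ → ℝ≥0∞} (hg : ∀ i, Measurable (g i)) :
    ∫⁻ y, ∏ i, g i (y i) ∂(Measure.pi μ) = ∏ i, ∫⁻ x, g i x ∂(μ i) := by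
  rw [lintegral_prod_eq_prod_lintegral_of_indepFun Finset.univ (fun i (y : ι → ℝ) => g i (y i))
    (iIndepFun_pi fun i => (hg i).aemeasurable)
    (fun i => (hg i).comp (measurable_pi_apply i))]
  refine Finset.prod_congr rfl fun i _ => ?_
  exact (measurePreserving_eval μ i).lintegral_comp (hg i)

/-- Both sides are product measures, so agreement on boxes suffices; there the integral factors into
one-dimensional exponential tilts. -/
theorem map_add_gaussian_eq_withDensity (v : ι → NNReal) (hv : ∀ z, v z ≠ 0) (m : ι → ℝ) :
    (Measure.pi fun z => gaussianReal 0 (v z)).map (fun y z => y z + m z) =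
      (Measure.pi fun z => gaussianReal 0 (v z)).withDensity
        fun y => ENNReal.ofReal (expTilt v m y) := by
  have : ∀ z, SigmaFinite ((gaussianReal 0 (v z)).map fun x => x + m z) := fun z => by
    rw [gaussianReal_map_add_const]
    infer_instance
  rw [Measure.pi_map_pi (f := fun z x => x + m z) fun z => by fun_prop]
  refine Measure.pi_eq fun s hs => ?_
  rw [withDensity_apply _ (MeasurableSet.univ_pi hs),
    ← lintegral_indicator (MeasurableSet.univ_pi hs)]
  let g : ι → ℝ → ℝ≥0∞ := fun z =>
    (s z).indicator fun x => ENNReal.ofReal (Real.exp (m z * x / v z - m z ^ 2 / (2 * v z)))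
  have hg : ∀ z, Measurable (g z) := fun z => Measurable.indicator (by fun_prop) (hs z)
  have h1 : ∀ y, (Set.univ.pi s).indicator (fun y => ENNReal.ofReal (expTilt v m y)) y =
      ∏ z, g z (y z) := by
    intro y
    by_cases hy : y ∈ Set.univ.pi s
    · rw [Set.indicator_of_mem hy, expTilt,
        ENNReal.ofReal_prod_of_nonneg fun _ _ => (Real.exp_pos _).le]
      refine Finset.prod_congr rfl fun z _ => ?_
      simp only [g]
      rw [Set.indicator_of_mem (hy z trivial)]
    · rw [Set.indicator_of_notMem hy]
      simp only [Set.mem_pi, Set.mem_univ, true_implies, not_forall] at hy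
      obtain ⟨z, hz⟩ := hy
      exact (Finset.prod_eq_zero (Finset.mem_univ z) (Set.indicator_of_notMem hz _)).symm
  simp only [h1]
  rw [lintegral_pi_prod hg]
  refine Finset.prod_congr rfl fun z _ => ?_
  rw [gaussianReal_map_add_const, zero_add, gaussianReal_eq_withDensity (hv z) (m z),
    withDensity_apply _ (hs z), ← lintegral_indicator (hs z)]

theorem memLp_expTilt (v : ι → NNReal) (m : ι → ℝ) :
    MemLp (expTilt v m) 2 (Measure.pi fun z => gaussianReal 0 (v z)) := by
  rw [memLp_two_iff_integrable_sq (measurable_expTilt v m).aestronglyMeasurable]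
  have h : ∀ y, expTilt v m y ^ 2 =
      ∏ z, Real.exp (-(m z ^ 2 / v z)) * Real.exp (2 * m z / v z * y z) := by
    intro y
    rw [expTilt, ← Finset.prod_pow]
    refine Finset.prod_congr rfl fun z _ => ?_
    rw [← Real.exp_add, ← Real.exp_nat_mul]
    congr 1
    push_cast
    ring
  simp only [h]
  exact Integrable.fintype_prod
    (f := fun z (x : ℝ) => Real.exp (-(m z ^ 2 / v z)) * Real.exp (2 * m z / v z * x))
    fun z => (integrable_exp_mul_gaussianReal _).const_mul _

/-! ### Finite mixtures of shifts, with coordinates repeated along a surjection. -/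

variable {κ : Type} {Ω : Type} [Fintype Ω]

/-- The law of independent centred Gaussians of variances `v`, shifted by a random element of the
finite family `m` with weights `w`, and reindexed along `e`. -/
noncomputable def gaussianMixture (v : ι → NNReal) (e : κ → ι) (w : Ω → ℝ) (m : Ω → ι → ℝ) :
    Measure (κ → ℝ) :=
  ∑ ω, ENNReal.ofReal (w ω) •
    (Measure.pi fun z => gaussianReal 0 (v z)).map fun y p => y (e p) + m ω (e p)

/-- The density of `gaussianMixture`. -/
noncomputable def mixtureDensity (v : ι → NNReal) {e : κ → ι} (he : e.Surjective) (w : Ω → ℝ)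
    (m : Ω → ι → ℝ) (Y : κ → ℝ) : ℝ :=
  ∑ ω, w ω * expTilt v (m ω) fun z => Y (Function.surjInv he z)

theorem measurable_mixtureDensity (v : ι → NNReal) {e : κ → ι} (he : e.Surjective) (w : Ω → ℝ)
    (m : Ω → ι → ℝ) : Measurable (mixtureDensity v he w m) :=
  Finset.measurable_sum _ fun ω _ =>
    ((measurable_expTilt v (m ω)).comp (by fun_prop)).const_mul _

/-- On vectors of the form y ∘ e, a section of the surjection recovers y, so the choice of section
disappears. -/
theorem mixtureDensity_comp (v : ι → NNReal) {e : κ → ι} (he : e.Surjective) (w : Ω → ℝ)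
    (m : Ω → ι → ℝ) (y : ι → ℝ) :
    mixtureDensity v he w m (fun p => y (e p)) = ∑ ω, w ω * expTilt v (m ω) y := by
  simp [mixtureDensity, Function.surjInv_eq]

theorem gaussianMixture_eq_withDensity (v : ι → NNReal) (hv : ∀ z, v z ≠ 0) {e : κ → ι}
    (he : e.Surjective) (w : Ω → ℝ) (hw : ∀ ω, 0 ≤ w ω) (m : Ω → ι → ℝ) :
    gaussianMixture v e w m =
      ((Measure.pi fun z => gaussianReal 0 (v z)).map fun y p => y (e p)).withDensity
        fun Y => ENNReal.ofReal (mixtureDensity v he w m Y) := by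
  ext s hs
  have hφ : Measurable fun (y : ι → ℝ) (p : κ) => y (e p) := by fun_prop
  rw [withDensity_apply _ hs, setLIntegral_map hs
    (measurable_mixtureDensity v he w m).ennreal_ofReal hφ]
  simp only [mixtureDensity_comp, gaussianMixture, Measure.coe_finsetSum, Finset.sum_apply,
    Measure.smul_apply, smul_eq_mul]
  simp only [ENNReal.ofReal_sum_of_nonneg fun ω _ => mul_nonneg (hw ω) (expTilt_nonneg v (m ω) _),
    ENNReal.ofReal_mul (hw _)]
  rw [lintegral_finsetSum _ fun ω _ =>
    (measurable_expTilt v (m ω)).ennreal_ofReal.const_mul _]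
  refine Finset.sum_congr rfl fun ω _ => ?_
  rw [lintegral_const_mul _ (measurable_expTilt v (m ω)).ennreal_ofReal,
    ← withDensity_apply _ (hφ hs), ← map_add_gaussian_eq_withDensity v hv,
    Measure.map_apply (by fun_prop) hs, Measure.map_apply (by fun_prop) (hφ hs)]
  rfl

theorem gaussianMixture_absolutelyContinuous (v : ι → NNReal) (hv : ∀ z, v z ≠ 0) {e : κ → ι}
    (he : e.Surjective) (w : Ω → ℝ) (hw : ∀ ω, 0 ≤ w ω) (m : Ω → ι → ℝ) :
    gaussianMixture v e w m ≪
      (Measure.pi fun z => gaussianReal 0 (v z)).map fun y p => y (e p) := by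
  rw [gaussianMixture_eq_withDensity v hv he w hw m]
  exact withDensity_absolutelyContinuous _ _

theorem memLp_likelihoodRatio_gaussianMixture (v : ι → NNReal) (hv : ∀ z, v z ≠ 0) {e : κ → ι}
    (he : e.Surjective) (w : Ω → ℝ) (hw : ∀ ω, 0 ≤ w ω) (m : Ω → ι → ℝ) :
    MemLp (likelihoodRatio (gaussianMixture v e w m)
        ((Measure.pi fun z => gaussianReal 0 (v z)).map fun y p => y (e p))) 2
      ((Measure.pi fun z => gaussianReal 0 (v z)).map fun y p => y (e p)) := by
  have hφ : Measurable fun (y : ι → ℝ) (p : κ) => y (e p) := by fun_prop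
  have : IsProbabilityMeasure
      ((Measure.pi fun z => gaussianReal 0 (v z)).map fun y p => y (e p)) :=
    Measure.isProbabilityMeasure_map hφ.aemeasurable
  have hm := measurable_mixtureDensity v he w m
  have h1 : MemLp (mixtureDensity v he w m) 2
      ((Measure.pi fun z => gaussianReal 0 (v z)).map fun y p => y (e p)) := by
    rw [memLp_map_measure_iff hm.aestronglyMeasurable hφ.aemeasurable]
    refine (memLp_congr_ae (Eventually.of_forall fun y => mixtureDensity_comp v he w m y)).2 ?_
    exact memLp_finsetSum Finset.univ fun ω _ => (memLp_expTilt v (m ω)).const_mul (w ω)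
  refine (memLp_congr_ae ?_).2 h1
  have h2 := Measure.rnDeriv_withDensity
    ((Measure.pi fun z => gaussianReal 0 (v z)).map fun y p => y (e p)) hm.ennreal_ofReal
  rw [← gaussianMixture_eq_withDensity v hv he w hw m] at h2
  filter_upwards [h2] with Y hY
  rw [likelihoodRatio, hY, ENNReal.toReal_ofReal]
  exact Finset.sum_nonneg fun ω _ => mul_nonneg (hw ω) (expTilt_nonneg _ _ _)

variable [Fintype κ]

theorem integral_eval_gaussianMixture (v : ι → NNReal) (e : κ → ι) (w : Ω → ℝ)
    (hw : ∀ ω, 0 ≤ w ω) (m : Ω → ι → ℝ) (p : MvPolynomial κ ℝ) :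
    ∫ Y, eval Y p ∂(gaussianMixture v e w m) =
      ∑ ω, w ω * ∫ y, eval (fun z => y z + m ω z) (rename e p)
        ∂(Measure.pi fun z => gaussianReal 0 (v z)) := by
  have hmeas : ∀ ω, Measurable fun (y : ι → ℝ) (p : κ) => y (e p) + m ω (e p) := by
    intro ω; fun_prop
  have hev : StronglyMeasurable fun Y : κ → ℝ => eval Y p :=
    (continuous_eval p).stronglyMeasurable
  have hcomp : ∀ ω (y : ι → ℝ), eval (fun p => y (e p) + m ω (e p)) p =
      eval (fun z => y z + m ω z) (rename e p) := by
    intro ω y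
    rw [eval_rename]
    rfl
  have hint : ∀ ω, Integrable (fun Y => eval Y p)
      ((Measure.pi fun z => gaussianReal 0 (v z)).map
        fun y p => y (e p) + m ω (e p)) := by
    intro ω
    rw [integrable_map_measure hev.aestronglyMeasurable (hmeas ω).aemeasurable]
    simp only [Function.comp_def, hcomp, eval_add_eq_sum_dirDeriv _ _ _ le_rfl]
    exact integrable_finsetSum _ fun k _ => (integrable_eval_gaussian v _).const_mul _
  rw [gaussianMixture, integral_finsetSum_measure fun ω _ =>
    (hint ω).smul_measure ENNReal.ofReal_ne_top]
  refine Finset.sum_congr rfl fun ω _ => ?_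
  rw [integral_smul_measure, ENNReal.toReal_ofReal (hw ω), smul_eq_mul,
    integral_map (hmeas ω).aemeasurable hev.aestronglyMeasurable]
  simp only [hcomp]

/-- Duality: ‖G‖² = ⟨L, G⟩ is the mixture expectation of a polynomial representing G. Pulling it
back along `e` does not raise the degree, so the shift bound gives ‖G‖⁴ ≤ ‖G‖² · S, and ‖G‖²
cancels. -/
theorem sq_norm_lowDegProj_gaussianMixture_le (v : ι → NNReal) (hv : ∀ z, v z ≠ 0) {e : κ → ι}
    (he : e.Surjective) (w : Ω → ℝ) (hw : ∀ ω, 0 ≤ w ω) (m : Ω → ι → ℝ) (D : ℕ)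
    (hL : MemLp (likelihoodRatio (gaussianMixture v e w m)
        ((Measure.pi fun z => gaussianReal 0 (v z)).map fun y p => y (e p))) 2
      ((Measure.pi fun z => gaussianReal 0 (v z)).map fun y p => y (e p))) :
    ‖lowDegProj _ D hL.toLp‖ ^ 2 ≤
      ∑ k ∈ Finset.range (D + 1), (k.factorial : ℝ)⁻¹ *
        ∑ ω, ∑ ω', w ω * w ω' * wInner v (m ω) (m ω') ^ k := by
  have hφ : Measurable fun (y : ι → ℝ) (p : κ) => y (e p) := by fun_prop
  set Q := (Measure.pi fun z => gaussianReal 0 (v z)).map fun y p => y (e p) with hQ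
  have : IsProbabilityMeasure Q := Measure.isProbabilityMeasure_map hφ.aemeasurable
  have hac := gaussianMixture_absolutelyContinuous v hv he w hw m
  rw [← hQ] at hac
  have hfin : IsFiniteMeasure (gaussianMixture v e w m) := by
    unfold gaussianMixture
    have : ∀ ω, IsFiniteMeasure (ENNReal.ofReal (w ω) •
        (Measure.pi fun z => gaussianReal 0 (v z)).map fun y p => y (e p) + m ω (e p)) :=
      fun ω => Measure.smul_finite _ ENNReal.ofReal_ne_top
    infer_instance
  set G := lowDegProj Q D hL.toLp with hG
  obtain ⟨p, hp, hGp⟩ : G ∈ polyLE Q D := Submodule.starProjection_apply_mem _ _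
  have hq : (rename e p).totalDegree ≤ D := (totalDegree_rename_le e p).trans hp
  have h1 : ‖G‖ ^ 2 = ∫ y, eval y (rename e p * rename e p)
      ∂(Measure.pi fun z => gaussianReal 0 (v z)) := by
    rw [← real_inner_self_eq_norm_sq, L2.inner_def]
    have : ∫ Y, inner ℝ (G Y) (G Y) ∂Q = ∫ Y, eval Y (p * p) ∂Q :=
      integral_congr_ae (by filter_upwards [hGp] with Y hY; simp [hY, sq])
    rw [this, hQ, integral_map hφ.aemeasurable (continuous_eval _).aestronglyMeasurable]
    congr 1 with y
    rw [← map_mul, eval_rename]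
    rfl
  have h2 : ‖G‖ ^ 2 = ∑ ω, w ω * ∫ y, eval (fun z => y z + m ω z) (rename e p)
      ∂(Measure.pi fun z => gaussianReal 0 (v z)) := by
    have h3 : ‖G‖ ^ 2 = inner ℝ hL.toLp G := by
      rw [← real_inner_self_eq_norm_sq]
      have := (polyLE Q D).starProjection_inner_eq_zero hL.toLp G
        (Submodule.starProjection_apply_mem _ _)
      rw [inner_sub_left, sub_eq_zero] at this
      exact this.symm
    have : (gaussianMixture v e w m).HaveLebesgueDecomposition Q :=
      Measure.haveLebesgueDecomposition_of_sigmaFinite _ _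
    rw [h3, L2.inner_def, ← integral_eval_gaussianMixture v e w hw m p,
      ← integral_rnDeriv_smul hac]
    refine integral_congr_ae ?_
    filter_upwards [hGp, hL.coeFn_toLp] with Y h4 h5
    rw [h4, h5]
    simp [likelihoodRatio, mul_comm]
  have h3 := sq_sum_integral_shift_le v hv w m (rename e p) hq
  rw [← h2, ← h1] at h3
  rcases eq_or_lt_of_le (sq_nonneg ‖G‖) with h0 | h0
  · rw [← h0]
    -- When G = 0 only nonnegativity of the bound is needed; the constant polynomial 1 supplies it.
    have h5 := sq_sum_integral_shift_le v hv w m (1 : MvPolynomial ι ℝ) (D := D) (by simp)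
    simp only [mul_one, map_one, integral_const, probReal_univ, smul_eq_mul, one_mul] at h5
    exact (sq_nonneg _).trans h5
  · rw [sq] at h3
    exact le_of_mul_le_mul_left h3 h0

end GaussianShift

/-! ### The spiked Wigner model as a finite Gaussian mixture. -/

section Model

/-- The variances of the entries of `goe n`. -/
noncomputable def goeVar (n : ℕ) (z : Sym2 (Fin n)) : NNReal :=
  if z.IsDiag then 2 / (n : NNReal) else 1 / (n : NNReal)

/-- An unordered pair of indices exists only if n > 0, so n = 0 needs no exception. -/
theorem goeVar_ne_zero (n : ℕ) (z : Sym2 (Fin n)) : goeVar n z ≠ 0 := by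
  have hn : (n : NNReal) ≠ 0 := by
    induction z using Sym2.ind with
    | _ i j => exact_mod_cast (Fin.pos i).ne'
  unfold goeVar
  split_ifs <;> simp [hn]

theorem measurable_reindex {κ ι : Type} (e : κ → ι) :
    Measurable fun (y : ι → ℝ) (p : κ) => y (e p) :=
  measurable_pi_lambda _ fun p => measurable_pi_apply (e p)

theorem goe_eq (n : ℕ) : goe n = (Measure.pi fun z => gaussianReal 0 (goeVar n z)).map
    fun y (p : Fin n × Fin n) => y s(p.1, p.2) := rfl

theorem surjective_sym2_mk (α : Type) : Function.Surjective fun p : α × α => s(p.1, p.2) := by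
  intro z
  induction z using Sym2.ind with
  | _ i j => exact ⟨(i, j), rfl⟩

/-- The values of an entry of the sparse Rademacher vector. -/
noncomputable def srValue (n : ℕ) (ρ : ℝ) : Fin 3 → ℝ :=
  ![1 / Real.sqrt (ρ * n), -(1 / Real.sqrt (ρ * n)), 0]

/-- The probabilities of the values of an entry of the sparse Rademacher vector. -/
noncomputable def srWeight (ρ : ℝ) : Fin 3 → ℝ := ![ρ / 2, ρ / 2, 1 - ρ]

theorem srWeight_nonneg {ρ : ℝ} (h0 : 0 < ρ) (h1 : ρ ≤ 1) (a : Fin 3) : 0 ≤ srWeight ρ a := by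
  fin_cases a <;> simp [srWeight, h1] <;> positivity

theorem sparseRademacherEntry_eq (n : ℕ) (ρ : ℝ) : sparseRademacherEntry n ρ =
    ∑ a, ENNReal.ofReal (srWeight ρ a) • Measure.dirac (srValue n ρ a) := by
  rw [Fin.sum_univ_three]
  rfl

theorem pi_sum_dirac {n : ℕ} {A : Type} [Fintype A] (w : A → ℝ) (hw : ∀ a, 0 ≤ w a)
    (c : A → ℝ) :
    Measure.pi (fun _ : Fin n => ∑ a, ENNReal.ofReal (w a) • Measure.dirac (c a)) =
      ∑ s : Fin n → A, ENNReal.ofReal (∏ i, w (s i)) • Measure.dirac fun i => c (s i) := by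
  have : ∀ a, IsFiniteMeasure (ENNReal.ofReal (w a) • Measure.dirac (c a)) := fun a =>
    Measure.smul_finite _ ENNReal.ofReal_ne_top
  refine Measure.pi_eq fun B hB => ?_
  simp only [Measure.coe_finsetSum, Finset.sum_apply, Measure.smul_apply, smul_eq_mul]
  rw [Fintype.prod_sum]
  refine Finset.sum_congr rfl fun s _ => ?_
  rw [Finset.prod_mul_distrib, ENNReal.ofReal_prod_of_nonneg fun i _ => hw _,
    Measure.dirac_apply' _ (MeasurableSet.univ_pi hB)]
  simp only [Measure.dirac_apply' _ (hB _)]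
  congr 1
  by_cases h : (fun i => c (s i)) ∈ Set.univ.pi B
  · rw [Set.indicator_of_mem h, Finset.prod_eq_one fun i _ => Set.indicator_of_mem (h i trivial) _]
    rfl
  · rw [Set.indicator_of_notMem h]
    simp only [Set.mem_pi, Set.mem_univ, true_implies, not_forall] at h
    obtain ⟨i, hi⟩ := h
    exact (Finset.prod_eq_zero (Finset.mem_univ i) (Set.indicator_of_notMem hi _)).symm

/-- The rank one spike `lam * x xᵀ`, as a function of an unordered pair of indices. -/
def spike {n : ℕ} (lam : ℝ) (x : Fin n → ℝ) (z : Sym2 (Fin n)) : ℝ :=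
  lam * Sym2.lift ⟨fun i j => x i * x j, fun _ _ => mul_comm _ _⟩ z

theorem spikedWigner_eq (n : ℕ) (lam : ℝ) {ρ : ℝ} (h0 : 0 < ρ) (h1 : ρ ≤ 1) :
    spikedWigner n lam (sparseRademacher n ρ) =
      gaussianMixture (goeVar n) (fun p : Fin n × Fin n => s(p.1, p.2))
        (fun s : Fin n → Fin 3 => ∏ i, srWeight ρ (s i))
        (fun s => spike lam fun i => srValue n ρ (s i)) := by
  have hprob : IsProbabilityMeasure (goe n) := by
    rw [goe_eq]
    exact Measure.isProbabilityMeasure_map (measurable_reindex _).aemeasurable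
  rw [spikedWigner, sparseRademacher, sparseRademacherEntry_eq,
    pi_sum_dirac _ (srWeight_nonneg h0 h1)]
  have hfin : ∀ s : Fin n → Fin 3, IsFiniteMeasure (ENNReal.ofReal (∏ i, srWeight ρ (s i)) •
      Measure.dirac fun i => srValue n ρ (s i)) := fun s =>
    Measure.smul_finite _ ENNReal.ofReal_ne_top
  ext B hB
  have hm : Measurable fun (w : (Fin n × Fin n → ℝ) × (Fin n → ℝ)) p =>
      w.1 p + lam * (w.2 p.1 * w.2 p.2) := by fun_prop
  rw [Measure.map_apply hm hB, Measure.prod_apply_symm (hm hB), lintegral_finsetSum_measure,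
    gaussianMixture]
  simp only [Measure.coe_finsetSum, Finset.sum_apply]
  refine Finset.sum_congr rfl fun s _ => ?_
  rw [lintegral_smul_measure, lintegral_dirac' _ (measurable_measure_prodMk_right (hm hB)),
    Measure.smul_apply, goe_eq, Measure.map_apply (measurable_reindex _)
      (measurable_prodMk_right (hm hB)),
    Measure.map_apply (measurable_pi_lambda _ fun p =>
      (measurable_pi_apply s(p.1, p.2)).add_const _) hB]
  rfl

theorem sum_sym2_mk {n : ℕ} (g : Sym2 (Fin n) → ℝ) :
    ∑ p : Fin n × Fin n, g s(p.1, p.2) = ∑ z, (if z.IsDiag then 1 else 2) * g z := by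
  rw [← Finset.sum_fiberwise (s := Finset.univ) (g := fun p : Fin n × Fin n => s(p.1, p.2))]
  refine Finset.sum_congr rfl fun z _ => ?_
  rw [Finset.sum_congr (g := fun _ => g z) rfl
    fun p hp => by rw [(Finset.mem_filter.1 hp).2], Finset.sum_const, nsmul_eq_mul]
  congr 1
  induction z using Sym2.ind with
  | _ i j =>
    have : (Finset.univ.filter fun p : Fin n × Fin n => s(p.1, p.2) = s(i, j)) =
        {(i, j), (j, i)} := by
      ext ⟨a, b⟩
      simp
    rw [this]
    by_cases hij : i = j
    · simp [hij]
    · rw [Finset.card_pair (by simp [hij]), if_neg (by simpa using hij)]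
      norm_num

/-- The inverse variance is n/2 times the number of ordered pairs over z: one on the diagonal, two
off it. The weighted sum is therefore n/2 times a full double sum, which factors as a square. -/
theorem wInner_spike {n : ℕ} (lam : ℝ) (x x' : Fin n → ℝ) :
    wInner (goeVar n) (spike lam x) (spike lam x') =
      n * lam ^ 2 / 2 * (∑ i, x i * x' i) ^ 2 := by
  let g : Sym2 (Fin n) → ℝ := fun z => n / 2 * (spike lam x z * spike lam x' z)
  have h : ∑ p : Fin n × Fin n, g s(p.1, p.2) = n * lam ^ 2 / 2 * (∑ i, x i * x' i) ^ 2 := by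
    rw [sq (∑ i, x i * x' i), Finset.sum_mul_sum, Finset.mul_sum, Fintype.sum_prod_type]
    refine Finset.sum_congr rfl fun i _ => ?_
    rw [Finset.mul_sum]
    refine Finset.sum_congr rfl fun j _ => ?_
    simp only [g, spike, Sym2.lift_mk]
    ring
  rw [← h, sum_sym2_mk, wInner]
  refine Finset.sum_congr rfl fun z _ => ?_
  simp only [g, goeVar]
  split_ifs <;> push_cast <;> field_simp

end Model

/-! ### Moments of the overlap and the bound on each degree. -/

section Moments

theorem pow_two_mul_le_factorial_mul_cosh (x : ℝ) (k : ℕ) :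
    x ^ (2 * k) ≤ (2 * k).factorial * Real.cosh x := by
  have h := le_hasSum (Real.hasSum_cosh x) k fun j _ => by
    rw [pow_mul]
    positivity
  have hk : (0 : ℝ) < (2 * k).factorial := by positivity
  rwa [div_le_iff₀' hk] at h

/-- A geometric bound on the remainder of the Taylor series of `cosh` at order four. -/
theorem cosh_le_taylor {t : ℝ} (ht : t ^ 2 < 30) :
    Real.cosh t ≤ 1 + t ^ 2 / 2 + t ^ 4 / 24 * (1 - t ^ 2 / 30)⁻¹ := by
  have h1 := (hasSum_nat_add_iff' 2).2 (Real.hasSum_cosh t)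
  have h2 := (hasSum_geometric_of_lt_one (r := t ^ 2 / 30) (by positivity)
    (by linarith)).mul_left (t ^ 4 / 24)
  -- From 4! on, each step multiplies the factorial by at least 5 · 6 = 30.
  have hfac : ∀ j : ℕ, (24 : ℝ) * 30 ^ j ≤ (2 * (j + 2)).factorial := by
    intro j
    induction j with
    | zero => norm_num [Nat.factorial]
    | succ j ih =>
      have : (2 * (j + 1 + 2)).factorial =
          (2 * (j + 2) + 2) * ((2 * (j + 2) + 1) * (2 * (j + 2)).factorial) := by
        rw [show 2 * (j + 1 + 2) = 2 * (j + 2) + 1 + 1 by ring, Nat.factorial_succ,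
          Nat.factorial_succ]
      rw [this]
      push_cast
      have hj : (0 : ℝ) ≤ j := by positivity
      calc (24 : ℝ) * 30 ^ (j + 1) = 30 * (24 * 30 ^ j) := by ring
        _ ≤ 30 * ((2 * (j + 2)).factorial : ℝ) := by gcongr
        _ ≤ ((2 * (j + 2) + 2) * (2 * (j + 2) + 1)) * ((2 * (j + 2)).factorial : ℝ) := by
          gcongr
          nlinarith
        _ = _ := by ring
  have h3 := hasSum_le (fun j => ?_) h1 h2
  · norm_num [Finset.sum_range_succ, Nat.factorial] at h3
    linarith
  · have e : t ^ 4 / 24 * (t ^ 2 / 30) ^ j = t ^ (2 * (j + 2)) / (24 * 30 ^ j) := by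
      rw [div_pow, ← pow_mul, show 2 * (j + 2) = 4 + 2 * j by ring, pow_add]
      field_simp
    rw [e]
    have : 0 ≤ t ^ (2 * (j + 2)) := by rw [pow_mul]; positivity
    exact div_le_div_of_nonneg_left this (by positivity) (hfac j)

theorem factorial_le_mul_pow {k : ℕ} (hk : 1 ≤ k) :
    (k.factorial : ℝ) ≤ Real.exp 1 * k * (k / Real.exp 1) ^ k := by
  induction k, hk using Nat.le_induction with
  | base => simp
  | succ k hk ih =>
    have hk0 : (0 : ℝ) < k := by exact_mod_cast hk
    -- This is e ≤ (1 + 1/k)^(k+1), from log x ≥ 1 - 1/x.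
    have he : Real.exp 1 * (k : ℝ) ^ (k + 1) ≤ (k + 1 : ℝ) ^ (k + 1) := by
      have h1 : (1 : ℝ) / (k + 1) ≤ Real.log ((k + 1) / k) := by
        have := Real.one_sub_inv_le_log_of_pos (x := ((k : ℝ) + 1) / k) (by positivity)
        refine le_trans (le_of_eq ?_) this
        field_simp
        ring
      have h2 : Real.exp 1 ≤ (((k : ℝ) + 1) / k) ^ (k + 1) := by
        rw [← Real.exp_log (x := ((k : ℝ) + 1) / k) (by positivity), ← Real.exp_nat_mul,
          Real.exp_le_exp]
        rw [div_le_iff₀ (by positivity)] at h1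
        push_cast
        linarith
      rwa [div_pow, le_div_iff₀ (by positivity)] at h2
    rw [Nat.factorial_succ]
    push_cast
    calc ((k : ℝ) + 1) * k.factorial
        ≤ (k + 1) * (Real.exp 1 * k * (k / Real.exp 1) ^ k) := by gcongr
      _ = (k + 1) * (Real.exp 1 * (k : ℝ) ^ (k + 1)) / Real.exp 1 ^ k := by
          rw [div_pow, pow_succ]
          field_simp
      _ ≤ (k + 1) * ((k + 1 : ℝ) ^ (k + 1)) / Real.exp 1 ^ k := by gcongr
      _ = _ := by
          rw [div_pow, pow_succ (Real.exp 1)]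
          field_simp

/-- The moment generating function of the overlap of two independent sparse Rademacher vectors. -/
theorem sum_srWeight_exp {n : ℕ} (hn : 0 < n) {ρ : ℝ} (h0 : 0 < ρ) (θ : ℝ) :
    ∑ s : Fin n → Fin 3, ∑ s' : Fin n → Fin 3,
      (∏ i, srWeight ρ (s i)) * (∏ i, srWeight ρ (s' i)) *
        Real.exp (θ * ∑ i, srValue n ρ (s i) * srValue n ρ (s' i)) =
      (1 + ρ ^ 2 * (Real.cosh (θ / (ρ * n)) - 1)) ^ n := by
  have h1 : ∀ s s' : Fin n → Fin 3, (∏ i, srWeight ρ (s i)) * (∏ i, srWeight ρ (s' i)) *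
      Real.exp (θ * ∑ i, srValue n ρ (s i) * srValue n ρ (s' i)) =
      ∏ i, srWeight ρ (s i) * srWeight ρ (s' i) *
        Real.exp (θ * (srValue n ρ (s i) * srValue n ρ (s' i))) := by
    intro s s'
    rw [Finset.mul_sum, Real.exp_sum, Finset.prod_mul_distrib, Finset.prod_mul_distrib]
  simp only [h1]
  have h2 : ∀ s : Fin n → Fin 3, ∑ s' : Fin n → Fin 3, ∏ i, srWeight ρ (s i) *
      srWeight ρ (s' i) * Real.exp (θ * (srValue n ρ (s i) * srValue n ρ (s' i))) =
      ∏ i, ∑ b, srWeight ρ (s i) * srWeight ρ b *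
        Real.exp (θ * (srValue n ρ (s i) * srValue n ρ b)) := fun s =>
    (Fintype.prod_sum fun i b => srWeight ρ (s i) * srWeight ρ b *
        Real.exp (θ * (srValue n ρ (s i) * srValue n ρ b))).symm
  simp only [h2]
  have hs := Fintype.prod_sum fun (_ : Fin n) a => ∑ b, srWeight ρ a * srWeight ρ b *
        Real.exp (θ * (srValue n ρ a * srValue n ρ b))
  rw [← hs, Finset.prod_const, Finset.card_univ, Fintype.card_fin]
  congr 1
  have hpos : 0 < ρ * n := by positivity
  have hsq : Real.sqrt (ρ * n) * Real.sqrt (ρ * n) = ρ * n := Real.mul_self_sqrt hpos.le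
  have hsq' : (Real.sqrt (ρ * n))⁻¹ * (Real.sqrt (ρ * n))⁻¹ = (ρ * n)⁻¹ := by
    rw [← mul_inv, hsq]
  simp only [Fin.sum_univ_three, srWeight, srValue, Matrix.cons_val_zero, Matrix.cons_val_one,
    Matrix.cons_val_two, Matrix.head_cons, Matrix.tail_cons, one_div, neg_mul, mul_neg, neg_neg,
    hsq', mul_zero, zero_mul, Real.exp_zero, Real.cosh_eq, div_eq_mul_inv θ]
  ring_nf
  rw [Real.exp_zero]
  ring

/-- The generating function is even in θ, so averaging it over ±θ gives E cosh(θ⟨x, x'⟩), which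
dominates each even moment termwise. -/
theorem sum_srWeight_overlap_pow_le {n : ℕ} (hn : 0 < n) {ρ : ℝ} (h0 : 0 < ρ) (h1 : ρ ≤ 1)
    (θ : ℝ) (k : ℕ) :
    θ ^ (2 * k) * ∑ s : Fin n → Fin 3, ∑ s' : Fin n → Fin 3,
      (∏ i, srWeight ρ (s i)) * (∏ i, srWeight ρ (s' i)) *
        (∑ i, srValue n ρ (s i) * srValue n ρ (s' i)) ^ (2 * k) ≤
      (2 * k).factorial * (1 + ρ ^ 2 * (Real.cosh (θ / (ρ * n)) - 1)) ^ n := by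
  have e1 := sum_srWeight_exp hn h0 θ
  have e2 := sum_srWeight_exp hn h0 (-θ)
  rw [neg_div, Real.cosh_neg] at e2
  have e3 : (1 + ρ ^ 2 * (Real.cosh (θ / (ρ * n)) - 1)) ^ n =
      ∑ s : Fin n → Fin 3, ∑ s' : Fin n → Fin 3,
        (∏ i, srWeight ρ (s i)) * (∏ i, srWeight ρ (s' i)) *
          Real.cosh (θ * ∑ i, srValue n ρ (s i) * srValue n ρ (s' i)) := by
    simp only [Real.cosh_eq (θ * _), mul_div_assoc', mul_add, ← Finset.sum_div,
      Finset.sum_add_distrib]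
    simp only [neg_mul] at e2
    rw [e1, e2]
    ring
  rw [e3, Finset.mul_sum, Finset.mul_sum]
  refine Finset.sum_le_sum fun s _ => ?_
  rw [Finset.mul_sum, Finset.mul_sum]
  refine Finset.sum_le_sum fun s' _ => ?_
  have hw : ∀ s : Fin n → Fin 3, 0 ≤ ∏ i, srWeight ρ (s i) := fun s =>
    Finset.prod_nonneg fun i _ => srWeight_nonneg h0 h1 _
  have h := pow_two_mul_le_factorial_mul_cosh
    (θ * ∑ i, srValue n ρ (s i) * srValue n ρ (s' i)) k
  rw [mul_pow] at h
  have := mul_le_mul_of_nonneg_left h (mul_nonneg (hw s) (hw s'))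
  linarith

/-- The degree `k` part of the squared norm of the likelihood ratio. -/
noncomputable def degreeTerm (n : ℕ) (lam ρ : ℝ) (k : ℕ) : ℝ :=
  (k.factorial : ℝ)⁻¹ * ∑ s : Fin n → Fin 3, ∑ s' : Fin n → Fin 3,
    (∏ i, srWeight ρ (s i)) * (∏ i, srWeight ρ (s' i)) *
      (n * lam ^ 2 / 2 * (∑ i, srValue n ρ (s i) * srValue n ρ (s' i)) ^ 2) ^ k

theorem degreeTerm_zero_le {n : ℕ} (hn : 0 < n) (lam : ℝ) {ρ : ℝ} (h0 : 0 < ρ) (h1 : ρ ≤ 1) :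
    degreeTerm n lam ρ 0 ≤ 1 := by
  have := sum_srWeight_overlap_pow_le hn h0 h1 0 0
  simpa [degreeTerm] using this

/-- Here t is a free Chernoff parameter, and `hr` measures the degree in units of n ρ². The bounds 1
+ u ≤ exp u and (2k)! ≤ 4^k (k!)² leave one factor k!, estimated by k! ≤ e k (k/e)^k. -/
theorem degreeTerm_le {n : ℕ} (hn : 0 < n) (lam : ℝ) {ρ : ℝ} (h0 : 0 < ρ) (h1 : ρ ≤ 1)
    {k : ℕ} (hk : 1 ≤ k) {t r : ℝ} (ht : 0 < t) (hr : r * (n * ρ ^ 2) = k) :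
    degreeTerm n lam ρ k ≤ Real.exp 1 * k *
      (2 * (lam ^ 2 * r) / (Real.exp 1 * t ^ 2) * Real.exp ((Real.cosh t - 1) / r)) ^ k := by
  have hk0 : (0 : ℝ) < k := by exact_mod_cast hk
  have hn0 : (0 : ℝ) < n := by exact_mod_cast hn
  have hμ : 0 < n * ρ ^ 2 := by positivity
  have hr0 : 0 < r := by
    by_contra! h
    nlinarith
  set S := ∑ s : Fin n → Fin 3, ∑ s' : Fin n → Fin 3,
    (∏ i, srWeight ρ (s i)) * (∏ i, srWeight ρ (s' i)) *
      (∑ i, srValue n ρ (s i) * srValue n ρ (s' i)) ^ (2 * k) with hS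
  have hT : degreeTerm n lam ρ k = (k.factorial : ℝ)⁻¹ * ((n * lam ^ 2 / 2) ^ k * S) := by
    rw [degreeTerm, hS]
    congr 1
    simp only [Finset.mul_sum, mul_pow _ (_ ^ 2) k, ← pow_mul]
    refine Finset.sum_congr rfl fun s _ => Finset.sum_congr rfl fun s' _ => ?_
    ring
  -- The choice θ = t ρ n makes the argument of cosh equal to t.
  have hbound := sum_srWeight_overlap_pow_le hn h0 h1 (t * (ρ * n)) k
  rw [← hS, mul_div_assoc, div_self (by positivity), mul_one] at hbound
  have hexp : (1 + ρ ^ 2 * (Real.cosh t - 1)) ^ n ≤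
      Real.exp ((Real.cosh t - 1) / r) ^ k := by
    have hc := Real.one_le_cosh t
    have h2 : 1 + ρ ^ 2 * (Real.cosh t - 1) ≤ Real.exp (ρ ^ 2 * (Real.cosh t - 1)) := by
      linarith [Real.add_one_le_exp (ρ ^ 2 * (Real.cosh t - 1))]
    refine (pow_le_pow_left₀ (by nlinarith [sq_nonneg ρ]) h2 n).trans (le_of_eq ?_)
    rw [← Real.exp_nat_mul, ← Real.exp_nat_mul, ← hr]
    congr 1
    field_simp
  have hfac : ((2 * k).factorial : ℝ) ≤ 4 ^ k * k.factorial * k.factorial := by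
    have h2 : (2 * k).factorial = k.centralBinom * k.factorial * k.factorial := by
      have := Nat.choose_mul_factorial_mul_factorial (show k ≤ 2 * k by omega)
      rw [show 2 * k - k = k by omega] at this
      exact this.symm
    have h3 : (k.centralBinom : ℝ) ≤ 4 ^ k := by
      have : (2 * k).choose k ≤ 2 ^ (2 * k) := Nat.choose_le_two_pow _ _
      rw [pow_mul] at this
      exact_mod_cast this
    rw [h2]
    push_cast
    gcongr
  have hS1 : S ≤ 4 ^ k * k.factorial * k.factorial * Real.exp ((Real.cosh t - 1) / r) ^ k /
      (t * (ρ * n)) ^ (2 * k) := by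
    rw [le_div_iff₀' (by positivity)]
    exact hbound.trans (mul_le_mul hfac hexp
      (pow_nonneg (by nlinarith [Real.one_le_cosh t, sq_nonneg ρ]) n) (by positivity))
  rw [hT]
  calc (k.factorial : ℝ)⁻¹ * ((n * lam ^ 2 / 2) ^ k * S)
      ≤ (k.factorial : ℝ)⁻¹ * ((n * lam ^ 2 / 2) ^ k *
        (4 ^ k * k.factorial * k.factorial * Real.exp ((Real.cosh t - 1) / r) ^ k /
          (t * (ρ * n)) ^ (2 * k))) := by gcongr
    _ = k.factorial * (2 * lam ^ 2 / (t ^ 2 * (n * ρ ^ 2)) *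
          Real.exp ((Real.cosh t - 1) / r)) ^ k := by
      have e : (k.factorial : ℝ) ≠ 0 := by positivity
      have e2 : 2 * lam ^ 2 / (t ^ 2 * (n * ρ ^ 2)) =
          n * lam ^ 2 / 2 * 4 / (t * (ρ * n)) ^ 2 := by
        field_simp
        ring
      rw [e2, mul_pow _ (Real.exp _), div_pow _ ((t * (ρ * n)) ^ 2), mul_pow _ (4 : ℝ), ← pow_mul]
      generalize (n * lam ^ 2 / 2) ^ k = A
      generalize (t * (ρ * n)) ^ (2 * k) = B
      field_simp
    _ ≤ (Real.exp 1 * k * (k / Real.exp 1) ^ k) * (2 * lam ^ 2 / (t ^ 2 * (n * ρ ^ 2)) *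
          Real.exp ((Real.cosh t - 1) / r)) ^ k := by
      gcongr
      exact factorial_le_mul_pow hk
    _ = _ := by
      rw [mul_assoc, ← mul_pow]
      congr 2
      rw [← hr]
      field_simp

/-- The Gaussian choice of the exponent in `degreeTerm_le`. -/
theorem degreeTerm_le_of_lt {n : ℕ} (hn : 0 < n) (lam : ℝ) {ρ : ℝ} (h0 : 0 < ρ) (h1 : ρ ≤ 1)
    {k : ℕ} (hk : 1 ≤ k) {r : ℝ} (hr : r * (n * ρ ^ 2) = k) (hr15 : r < 15) :
    degreeTerm n lam ρ k ≤ Real.exp 1 * k *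
      (lam ^ 2 * Real.exp (r / 6 * (1 - r / 15)⁻¹)) ^ k := by
  have hk0 : (0 : ℝ) < k := by exact_mod_cast hk
  have hμ : 0 < n * ρ ^ 2 := by positivity
  have hr0 : 0 < r := by
    by_contra! h
    nlinarith
  -- t² = 2r minimises t⁻² exp(t² / (2r)), the leading part of the bound; the resulting factor e
  -- cancels the one in the denominator.
  have ht2 : Real.sqrt (2 * r) ^ 2 = 2 * r := Real.sq_sqrt (by positivity)
  have hcosh := cosh_le_taylor (t := Real.sqrt (2 * r)) (by rw [ht2]; linarith)
  rw [show Real.sqrt (2 * r) ^ 4 = (Real.sqrt (2 * r) ^ 2) ^ 2 by ring, ht2,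
    show 2 * r / 30 = r / 15 by ring] at hcosh
  refine (degreeTerm_le hn lam h0 h1 hk (Real.sqrt_pos.2 (by positivity : 0 < 2 * r)) hr).trans ?_
  rw [ht2]
  have e : 2 * (lam ^ 2 * r) / (Real.exp 1 * (2 * r)) * Real.exp ((Real.cosh √(2 * r) - 1) / r) =
      lam ^ 2 * Real.exp ((Real.cosh √(2 * r) - 1) / r - 1) := by
    rw [Real.exp_sub]
    field_simp
  rw [e]
  gcongr
  rw [sub_le_iff_le_add, div_le_iff₀ hr0]
  linarith

end Moments

/-! ### Geometric decay in the two regimes and summation over degrees. -/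

section Bounds

theorem overlap_ratio {n : ℕ} (hn : 0 < n) {ρ : ℝ} (h0 : 0 < ρ) (k : ℕ) :
    (k / (n * ρ ^ 2) : ℝ) * (n * ρ ^ 2) = k := by
  have : (0 : ℝ) < n := by exact_mod_cast hn
  field_simp

/-- If `lam ≤ 1 / √3` and `lam * √(k / n) ≤ ρ`, the degree `k` part decays geometrically. -/
theorem degreeTerm_le_geometric_of_sq_le {n : ℕ} (hn : 0 < n) {lam ρ : ℝ} (h0 : 0 < ρ)
    (h1 : ρ ≤ 1) (hlam : lam ^ 2 ≤ 1 / 3) {k : ℕ} (hk : 1 ≤ k)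
    (hρ : lam ^ 2 * k ≤ n * ρ ^ 2) :
    degreeTerm n lam ρ k ≤ Real.exp 1 * (k * (2 / 3) ^ k) := by
  have hn0 : (0 : ℝ) < n := by exact_mod_cast hn
  have hk0 : (0 : ℝ) < k := by exact_mod_cast hk
  have hμ : 0 < n * ρ ^ 2 := by positivity
  set r : ℝ := k / (n * ρ ^ 2) with hr
  have hr0 : 0 < r := by positivity
  have he := Real.exp_one_gt_d9
  have he' := Real.exp_one_lt_d9
  rw [← mul_assoc]
  -- For r ≤ 3 the exponent is at most (1/2)(5/4) = 5/8. For larger r, t = 2 is used: cosh 2 - 1 < 3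
  -- < r, while λ² r ≤ 1 bounds the prefactor.
  rcases le_or_gt r 3 with h3 | h3
  · refine (degreeTerm_le_of_lt hn lam h0 h1 hk (overlap_ratio hn h0 k)
      (h3.trans_lt (by norm_num))).trans ?_
    rw [← hr]
    gcongr
    have ha : r / 6 * (1 - r / 15)⁻¹ ≤ 5 / 8 := by
      rw [← div_eq_mul_inv, div_le_iff₀ (by linarith)]
      linarith
    have hb : Real.exp (5 / 8) ≤ 2 := by
      rw [← Real.le_log_iff_exp_le (by norm_num)]
      linarith [Real.log_two_gt_d9]
    calc lam ^ 2 * Real.exp (r / 6 * (1 - r / 15)⁻¹)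
        ≤ 1 / 3 * 2 := mul_le_mul hlam ((Real.exp_le_exp.2 ha).trans hb)
          (Real.exp_pos _).le (by norm_num)
      _ = 2 / 3 := by norm_num
  · refine (degreeTerm_le hn lam h0 h1 hk (t := 2) (by norm_num)
      (overlap_ratio hn h0 k)).trans ?_
    rw [← hr]
    gcongr
    have hlr : lam ^ 2 * r ≤ 1 := by
      rw [hr, ← mul_div_assoc, div_le_one hμ]
      exact hρ
    have hc : (Real.cosh 2 - 1) / r ≤ 1 := by
      have := cosh_le_taylor (t := 2) (by norm_num)
      norm_num at this
      rw [div_le_one hr0]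
      linarith
    calc 2 * (lam ^ 2 * r) / (Real.exp 1 * 2 ^ 2) * Real.exp ((Real.cosh 2 - 1) / r)
        ≤ 2 * 1 / (Real.exp 1 * 2 ^ 2) * Real.exp 1 := by gcongr
      _ = 1 / 2 := by field_simp
      _ ≤ 2 / 3 := by norm_num

/-- If `lam ≤ c < 1`, the degree `k` part decays geometrically in the first regime. -/
theorem degreeTerm_le_geometric_of_lt_one {n : ℕ} (hn : 0 < n) {lam ρ c : ℝ} (h0 : 0 < ρ)
    (h1 : ρ ≤ 1) (hlam0 : 0 ≤ lam) (hlam : lam ≤ c) (hc : c < 1) {k : ℕ} (hk : 1 ≤ k)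
    (hρ : k ≤ n * ρ ^ 2)
    (hρ' : 1 / (6 * Real.log (1 / lam)) * k ≤ n * ρ ^ 2) :
    degreeTerm n lam ρ k ≤ Real.exp 1 * (k * Real.sqrt c ^ k) := by
  have hn0 : (0 : ℝ) < n := by exact_mod_cast hn
  have hk0 : (0 : ℝ) < k := by exact_mod_cast hk
  have hμ : 0 < n * ρ ^ 2 := by positivity
  set r : ℝ := k / (n * ρ ^ 2) with hr
  have hr0 : 0 < r := by positivity
  have hr1 : r ≤ 1 := by rw [hr, div_le_one hμ]; exact hρ
  rw [← mul_assoc]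
  refine (degreeTerm_le_of_lt hn lam h0 h1 hk (overlap_ratio hn h0 k)
    (hr1.trans_lt (by norm_num))).trans ?_
  rw [← hr]
  gcongr
  rcases hlam0.eq_or_lt with rfl | hpos
  · simp
  have hlog : 0 < Real.log (1 / lam) := Real.log_pos (by rw [lt_div_iff₀ hpos]; linarith)
  have hrlog : r / 6 ≤ Real.log (1 / lam) := by
    rw [hr, div_div, div_le_iff₀ (by positivity)]
    rw [div_mul_eq_mul_div, one_mul, div_le_iff₀ (by positivity)] at hρ'
    linarith
  -- Any constant below 2 in place of 3/2 would leave a positive power of λ; with 3/2, λ² · λ^(-3/2)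
  -- = √λ.
  have ha : r / 6 * (1 - r / 15)⁻¹ ≤ 3 / 2 * Real.log (1 / lam) := by
    have h2 : (1 - r / 15)⁻¹ ≤ 3 / 2 := by
      rw [inv_le_comm₀ (by linarith) (by norm_num)]
      linarith
    have h3 : 0 ≤ (1 - r / 15)⁻¹ := inv_nonneg.2 (by linarith)
    calc r / 6 * (1 - r / 15)⁻¹ ≤ Real.log (1 / lam) * (3 / 2) := by gcongr
      _ = _ := by ring
  have hb : lam ^ 2 * Real.exp (3 / 2 * Real.log (1 / lam)) = Real.sqrt lam := by
    rw [Real.sqrt_eq_rpow, Real.rpow_def_of_pos hpos, one_div, Real.log_inv]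
    nth_rw 1 [← Real.exp_log hpos]
    rw [← Real.exp_nat_mul, ← Real.exp_add]
    congr 1
    push_cast
    ring
  calc lam ^ 2 * Real.exp (r / 6 * (1 - r / 15)⁻¹)
      ≤ lam ^ 2 * Real.exp (3 / 2 * Real.log (1 / lam)) := by gcongr
    _ = Real.sqrt lam := hb
    _ ≤ Real.sqrt c := Real.sqrt_le_sqrt hlam

theorem sum_degreeTerm_le {n : ℕ} (hn : 0 < n) {lam ρ q : ℝ} (h0 : 0 < ρ) (h1 : ρ ≤ 1)
    (hq0 : 0 ≤ q) (hq1 : q < 1) (D : ℕ)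
    (h : ∀ k, 1 ≤ k → k ≤ D → degreeTerm n lam ρ k ≤ Real.exp 1 * (k * q ^ k)) :
    ∑ k ∈ Finset.range (D + 1), degreeTerm n lam ρ k ≤
      Real.exp 1 * (q / (1 - q) ^ 2) + 1 := by
  rw [Finset.sum_range_succ']
  refine add_le_add ?_ (degreeTerm_zero_le hn lam h0 h1)
  have hs := hasSum_coe_mul_geometric_of_norm_lt_one (𝕜 := ℝ) (r := q)
    (by rwa [Real.norm_of_nonneg hq0])
  calc ∑ k ∈ Finset.range D, degreeTerm n lam ρ (k + 1)
      ≤ ∑ k ∈ Finset.range D, Real.exp 1 * (((k + 1 : ℕ) : ℝ) * q ^ (k + 1)) :=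
        Finset.sum_le_sum fun k hk => h (k + 1) (by omega)
          (by have := Finset.mem_range.1 hk; omega)
    _ ≤ ∑ k ∈ Finset.range (D + 1), Real.exp 1 * ((k : ℝ) * q ^ k) := by
        rw [Finset.sum_range_succ' _ D]
        simp
    _ ≤ Real.exp 1 * (q / (1 - q) ^ 2) := by
        rw [← Finset.mul_sum]
        gcongr
        exact sum_le_hasSum _ (fun k _ => by positivity) hs

theorem sq_norm_lowDegProj_spikedWigner_le (n : ℕ) (lam : ℝ) {ρ : ℝ} (h0 : 0 < ρ) (h1 : ρ ≤ 1)
    (D : ℕ) (hL : MemLp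
      (likelihoodRatio (spikedWigner n lam (sparseRademacher n ρ)) (goe n)) 2 (goe n)) :
    ‖lowDegProj (goe n) D hL.toLp‖ ^ 2 ≤ ∑ k ∈ Finset.range (D + 1), degreeTerm n lam ρ k := by
  have h := fun hL' => sq_norm_lowDegProj_gaussianMixture_le (goeVar n) (goeVar_ne_zero n)
    (surjective_sym2_mk (Fin n)) (fun s : Fin n → Fin 3 => ∏ i, srWeight ρ (s i))
    (fun s => Finset.prod_nonneg fun i _ => srWeight_nonneg h0 h1 _)
    (fun s => spike lam fun i => srValue n ρ (s i)) D hL'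
  simp only [← goe_eq, ← spikedWigner_eq n lam h0 h1, wInner_spike] at h
  exact h hL

/-- A real number strictly between the limsup and a provides the uniform gap. Taking the limsup in
`EReal` avoids any boundedness assumption. -/
theorem eventually_lt_of_limsup_coe_lt {u : ℕ → ℝ} {a : ℝ}
    (h : limsup (fun n => (u n : EReal)) atTop < (a : EReal)) :
    ∃ c < a, ∀ᶠ n in atTop, u n < c := by
  obtain ⟨b, hb, hba⟩ := EReal.lt_iff_exists_real_btwn.1 h
  refine ⟨b, by exact_mod_cast hba, ?_⟩
  filter_upwards [eventually_lt_of_limsup_lt hb] with n hn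
  exact_mod_cast hn

theorem exists_eventually_sum_degreeTerm_le (D : ℕ → ℕ) (lam ρ : ℕ → ℝ)
    (hlam : ∀ n, 0 ≤ lam n) (hρ : ∀ n, 0 < ρ n ∧ ρ n ≤ 1)
    (hcase :
      (limsup (fun n => (lam n : EReal)) atTop < 1 ∧
        ∀ᶠ n : ℕ in atTop,
          max 1 (Real.sqrt (1 / (6 * Real.log (1 / lam n)))) * Real.sqrt (D n / n) ≤ ρ n) ∨
      (limsup (fun n => (lam n : EReal)) atTop < ((1 / Real.sqrt 3 : ℝ) : EReal) ∧
        ∀ᶠ n : ℕ in atTop, lam n * Real.sqrt (D n / n) ≤ ρ n)) :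
    ∃ C : ℝ, ∀ᶠ n in atTop,
      ∑ k ∈ Finset.range (D n + 1), degreeTerm n (lam n) (ρ n) k ≤ C := by
  -- The squared sparsity condition at degree D passes to every k ≤ D, which is how the hypotheses
  -- bound r.
  have hsq : ∀ n : ℕ, 0 < n → ∀ a : ℝ, 0 ≤ a → a * Real.sqrt (D n / n) ≤ ρ n →
      ∀ k ≤ D n, a ^ 2 * k ≤ n * ρ n ^ 2 := by
    intro n hn a ha h k hk
    have hn0 : (0 : ℝ) < n := by exact_mod_cast hn
    have h2 := pow_le_pow_left₀ (by positivity) h 2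
    rw [mul_pow, Real.sq_sqrt (by positivity), ← mul_div_assoc, div_le_iff₀ hn0] at h2
    have h3 : (k : ℝ) ≤ D n := by exact_mod_cast hk
    nlinarith [mul_le_mul_of_nonneg_left h3 (sq_nonneg a)]
  rcases hcase with ⟨hl, hr⟩ | ⟨hl, hr⟩
  · obtain ⟨c, hc, hlc⟩ := eventually_lt_of_limsup_coe_lt (a := 1) (by exact_mod_cast hl)
    refine ⟨Real.exp 1 * (Real.sqrt c / (1 - Real.sqrt c) ^ 2) + 1, ?_⟩
    filter_upwards [hlc, hr, eventually_gt_atTop 0] with n h1 h2 hn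
    have hc0 : 0 < c := (hlam n).trans_lt h1
    refine sum_degreeTerm_le hn (hρ n).1 (hρ n).2 (Real.sqrt_nonneg c)
      (by rw [Real.sqrt_lt' one_pos]; linarith) (D n) fun k hk hkD => ?_
    have hle : ∀ a, a ≤ max 1 (Real.sqrt (1 / (6 * Real.log (1 / lam n)))) →
        a * Real.sqrt (D n / n) ≤ ρ n := fun a ha =>
      (mul_le_mul_of_nonneg_right ha (Real.sqrt_nonneg _)).trans h2
    refine degreeTerm_le_geometric_of_lt_one hn (hρ n).1 (hρ n).2 (hlam n) h1.le hc hk ?_ ?_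
    · simpa using hsq n hn 1 zero_le_one (hle 1 (le_max_left _ _)) k hkD
    · have h3 := hsq n hn _ (Real.sqrt_nonneg _) (hle _ (le_max_right _ _)) k hkD
      rwa [Real.sq_sqrt] at h3
      -- At λ = 0 the conventions 1 / 0 = 0 and log 0 = 0 make the inner quantity 0, as the theorem
      -- prescribes.
      rcases (hlam n).eq_or_lt with h0 | h0
      · simp [← h0]
      · have : 0 ≤ Real.log (1 / lam n) :=
          Real.log_nonneg (by rw [le_div_iff₀ h0]; linarith)
        positivity
  · obtain ⟨c, hc, hlc⟩ := eventually_lt_of_limsup_coe_lt hl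
    refine ⟨Real.exp 1 * (2 / 3 / (1 - 2 / 3) ^ 2) + 1, ?_⟩
    filter_upwards [hlc, hr, eventually_gt_atTop 0] with n h1 h2 hn
    refine sum_degreeTerm_le hn (hρ n).1 (hρ n).2 (by norm_num) (by norm_num) (D n)
      fun k hk hkD => ?_
    have h3 : lam n ^ 2 ≤ 1 / 3 := by
      have := pow_le_pow_left₀ (hlam n) (h1.trans hc).le 2
      rwa [div_pow, Real.sq_sqrt (by norm_num), one_pow] at this
    exact degreeTerm_le_geometric_of_sq_le hn (hρ n).1 (hρ n).2 h3 hk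
      (hsq n hn _ (hlam n) h2 k hkD)

end Bounds

theorem mainTheorem6 (D : ℕ → ℕ) (lam ρ : ℕ → ℝ)
    (hlam : ∀ n, 0 ≤ lam n) (hρ : ∀ n, 0 < ρ n ∧ ρ n ≤ 1)
    (hD : (fun n => (D n : ℝ)) =o[atTop] fun n : ℕ => (n : ℝ))
    (hcase :
      (limsup (fun n => (lam n : EReal)) atTop < 1 ∧
        ∀ᶠ n : ℕ in atTop,
          max 1 (Real.sqrt (1 / (6 * Real.log (1 / lam n)))) * Real.sqrt (D n / n) ≤ ρ n) ∨
      (limsup (fun n => (lam n : EReal)) atTop < ((1 / Real.sqrt 3 : ℝ) : EReal) ∧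
        ∀ᶠ n : ℕ in atTop, lam n * Real.sqrt (D n / n) ≤ ρ n)) :
    (∀ n, spikedWigner n (lam n) (sparseRademacher n (ρ n)) ≪ goe n) ∧
    ∃ hL : ∀ n, MemLp
        (likelihoodRatio (spikedWigner n (lam n) (sparseRademacher n (ρ n))) (goe n)) 2 (goe n),
      (fun n => ‖lowDegProj (goe n) (D n) (hL n).toLp‖) =O[atTop] fun _ => (1 : ℝ) := by
  have hw : ∀ n (s : Fin n → Fin 3), 0 ≤ ∏ i, srWeight (ρ n) (s i) := fun n s =>
    Finset.prod_nonneg fun i _ => srWeight_nonneg (hρ n).1 (hρ n).2 _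
  refine ⟨fun n => ?_, fun n => ?_, ?_⟩
  · rw [spikedWigner_eq n (lam n) (hρ n).1 (hρ n).2]
    exact gaussianMixture_absolutelyContinuous _ (goeVar_ne_zero n)
      (surjective_sym2_mk (Fin n)) _ (hw n) _
  · rw [spikedWigner_eq n (lam n) (hρ n).1 (hρ n).2]
    exact memLp_likelihoodRatio_gaussianMixture _ (goeVar_ne_zero n)
      (surjective_sym2_mk (Fin n)) _ (hw n) _
  · obtain ⟨C, hC⟩ := exists_eventually_sum_degreeTerm_le D lam ρ hlam hρ hcase
    refine IsBigO.of_bound (Real.sqrt C) ?_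
    filter_upwards [hC] with n hn
    rw [norm_norm, norm_one, mul_one]
    exact Real.le_sqrt_of_sq_le
      ((sq_norm_lowDegProj_spikedWigner_le n (lam n) (hρ n).1 (hρ n).2 (D n) _).trans hn)
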